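/- **Theorem (hyperbolicity of the DVD-EQMOM moment system).** *Setting.* Let $D_x\le D$ and $N$ be natural numbers, let $\tau>0$, let $\bm l_1,\dots,\bm l_N\in\mathbb R^D$ be unit vectors, and let $N_1',\dots,N_N'\ge 1$ be integers. Let $\Delta_k(u,s)=\int_{\mathbb R}\xi^k\frac1{\sqrt{2\pi s}}e^{-(\xi-u)^2/(2s)}\,d\xi$ be the $k$-th moment of the Gaussian with center $u$ and variance $s>0$. *One-dimensional closure.* For $n\ge1$ let $\Omega_n\subset\mathbb R^{2n+1}$ be the set of vectors $M=(M_0,\dots,M_{2n})$ for which there are weights $w_1,\dots,w_n>0$, pairwise distinct nodes $v_1,\dots,v_n\in\mathbb R$ and a variance $\vartheta>0$ with $$M_k=\sum_{\alpha=1}^n w_\alpha\,\Delta_k(v_\alpha,\vartheta),\qquad k=0,\dots,2n .$$ For $M\in\Omega_n$ put $\bar M_{2n+1}(M)=\sum_{\alpha=1}^n w_\alpha\Delta_{2n+1}(v_\alpha,\vartheta)$, and let $A_n(M)\in\mathbb R^{(2n+1)\times(2n+1)}$ be the matrix with ones on the superdiagonal, last row $\bigl(\partial\bar M_{2n+1}/\partial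 M_0,\dots,\partial\bar M_{2n+1}/\partial M_{2n}\bigr)$, and zeros elsewhere. *The moment system.* The DVD-EQMOM system for $\mathcal M=(M_1^T,\dots,M_N^T)^T$ with $M_m=(M_{m,0},\dots,M_{m,2N_m'})^T\in\Omega_{N_m'}$ is $$\partial_t\mathcal M+\sum_{i=1}^{D_x}A^{(i)}(\mathcal M)\,\partial_{x_i}\mathcal M=\frac1\tau\,(M_{\mathcal E}-\mathcal M),$$ $$A^{(i)}(\mathcal M)=\mathrm{diag}\bigl\{(\bm l_1)_i\,A_{N_1'}(M_1),\dots,(\bm l_N)_i\,A_{N_N'}(M_N)\bigr\}.$$ Here $(M_{\mathcal E})_{m,k}=\rho_m\Delta_k(u_m,\sigma^2)$, with $\sigma^2=-1/\alpha_{D+1}$, $u_m=\bm l_m\cdot(\sigma^2\hat{\bm\alpha})$ and $\rho_m=\sqrt{2\pi}\,\sigma\exp\bigl(\alpha_0+u_m^2/(2\sigma^2)\bigr)$, where $\bm\alpha=(\alpha_0,\hat{\bm\alpha},\alpha_{D+1})\in\mathbb R\times\mathbb R^D\times\mathbb R$, $\alpha_{D+1}<0$, solves $$\sum_{m=1}^N\int_{\mathbb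 R}\bm m_m e^{\bm\alpha\cdot\bm m_m}\,d\xi=\sum_{m=1}^N\Bigl(M_{m,0},\ M_{m,1}\bm l_m,\ \tfrac12M_{m,2}\Bigr),\qquad \bm m_m(\xi)=\bigl(1,\xi\bm l_m,\tfrac12\xi^2\bigr).$$ *Conclusion.* 1. For every $m$, with $n=N_m'$: the set $\Omega_n$ is open, $\bar M_{2n+1}$ is a well-defined function on $\Omega_n$ (its value does not depend on the choice of $(w,v,\vartheta)$ representing $M$), and it is differentiable there. Hence the matrices $A^{(i)}$ are well defined. 2. The moment system is hyperbolic: for every state $\mathcal M$ with $M_m\in\Omega_{N_m'}$ for all $m$, and for every $\bm y\in\mathbb R^{D_x}$, the matrix $\sum_{i=1}^{D_x}y_iA^{(i)}(\mathcal M)$ is diagonalizable over $\mathbb R$. -/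

import Mathlib

open scoped BigOperators

noncomputable section

/-! ## Quasilinear first-order systems and hyperbolicity -/

/-- A real square matrix is real diagonalizable if it is similar over `ℝ` to a real
diagonal matrix. -/
def IsRealDiagonalizable {ι : Type} [Fintype ι] [DecidableEq ι] (A : Matrix ι ι ℝ) : Prop :=
  ∃ (P : (Matrix ι ι ℝ)ˣ) (e : ι → ℝ),
    A = (P : Matrix ι ι ℝ) * Matrix.diagonal e * ((P⁻¹ : (Matrix ι ι ℝ)ˣ) : Matrix ι ι ℝ)

/-- The quasilinear first-order system
`∂_t U + ∑ i, coeff i U * ∂_{x_i} U = source U` in `d` space variables,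
for unknowns `U = U(t, x)` with values in the set `domain` of admissible states. -/
structure QuasilinearSystem (d : ℕ) (ι : Type) where
  domain : Set (ι → ℝ)
  coeff : Fin d → (ι → ℝ) → Matrix ι ι ℝ
  source : (ι → ℝ) → (ι → ℝ)

/-- The system is hyperbolic if at every admissible state `U` and for every `y`
the matrix `∑ i, y i * coeff i U` is real diagonalizable. -/
def QuasilinearSystem.IsHyperbolic {d : ℕ} {ι : Type} [Fintype ι] [DecidableEq ι]
    (S : QuasilinearSystem d ι) : Prop :=
  ∀ U ∈ S.domain, ∀ y : Fin d → ℝ, IsRealDiagonalizable (∑ i, y i • S.coeff i U)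

/-! ## One-dimensional Gaussian-EQMOM closure -/

/-- `Δ_k(u, s)`: the `k`-th moment of the normalized Gaussian with center `u` and
variance `s`. -/
def gaussianMoment (k : ℕ) (u s : ℝ) : ℝ :=
  ∫ ξ : ℝ, ξ ^ k * (1 / Real.sqrt (2 * Real.pi * s) * Real.exp (-(ξ - u) ^ 2 / (2 * s)))

/-- The `k`-th moment of the sum of `n` Gaussians with weights `w`, centers `v` and common
variance `θ`. -/
def eqmomMoment {n : ℕ} (w v : Fin n → ℝ) (θ : ℝ) (k : ℕ) : ℝ :=
  ∑ a, w a * gaussianMoment k (v a) θ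

/-- The parameters of a nondegenerate `n`-node Gaussian sum: positive weights,
pairwise distinct nodes, positive variance. -/
structure EqmomAdmissible {n : ℕ} (w v : Fin n → ℝ) (θ : ℝ) : Prop where
  weight_pos : ∀ a, 0 < w a
  node_injective : Function.Injective v
  variance_pos : 0 < θ

/-- The first `2 n + 1` moments `(M_0, …, M_{2n})` of the Gaussian sum. -/
def eqmomMomentVector {n : ℕ} (w v : Fin n → ℝ) (θ : ℝ) : Fin (2 * n + 1) → ℝ :=
  fun k => eqmomMoment w v θ k

/-- The moment vectors that arise from nondegenerate `n`-node Gaussian sums. -/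
def eqmomRealizable (n : ℕ) : Set (Fin (2 * n + 1) → ℝ) :=
  {M | ∃ (w v : Fin n → ℝ) (θ : ℝ), EqmomAdmissible w v θ ∧ eqmomMomentVector w v θ = M}

open Classical in
/-- The reconstructed moment of order `2 n + 1` as a function of `(M_0, …, M_{2n})`: invert the
moment equations for the weights, nodes and variance, and take the `(2 n + 1)`-st moment
of the resulting Gaussian sum. (Value `0` outside the realizable set.) -/
def eqmomClosure (n : ℕ) (M : Fin (2 * n + 1) → ℝ) : ℝ :=
  if h : ∃ p : (Fin n → ℝ) × (Fin n → ℝ) × ℝ,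
      EqmomAdmissible p.1 p.2.1 p.2.2 ∧ eqmomMomentVector p.1 p.2.1 p.2.2 = M then
    eqmomMoment h.choose.1 h.choose.2.1 h.choose.2.2 (2 * n + 1)
  else 0

/-- The coefficient matrix of the closed one-dimensional moment system: ones on the
superdiagonal, and the partial derivatives of the reconstructed moment in the last row. -/
def eqmomMatrix (n : ℕ) (M : Fin (2 * n + 1) → ℝ) :
    Matrix (Fin (2 * n + 1)) (Fin (2 * n + 1)) ℝ :=
  Matrix.of fun i j =>
    if i = Fin.last (2 * n) then fderiv ℝ (eqmomClosure n) M (Pi.single j 1)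
    else if (j : ℕ) = (i : ℕ) + 1 then 1 else 0

/-! ## Discrete equilibrium of the discrete-velocity-direction BGK model -/

/-- `exp (α · m_m(ξ))` with `m_m(ξ) = (1, ξ l_m, ξ² / 2)`, where `l` is the direction `l_m` and
`α = (α_0, \hat α, α_{D+1})`. -/
def dvdExp {D : ℕ} (α : ℝ × EuclideanSpace ℝ (Fin D) × ℝ)
    (l : EuclideanSpace ℝ (Fin D)) (ξ : ℝ) : ℝ :=
  Real.exp (α.1 + inner ℝ α.2.1 (ξ • l) + α.2.2 * (ξ ^ 2 / 2))

/-- `α` (with `α_{D+1} < 0`) solves the equilibrium equations: the tuple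
`(exp (α · m_m))_m` has the macroscopic density, momentum and energy
`r = (ρ, ρ U, ρ E)`. -/
def IsEquilibriumParameter {D N : ℕ} (l : Fin N → EuclideanSpace ℝ (Fin D))
    (r α : ℝ × EuclideanSpace ℝ (Fin D) × ℝ) : Prop :=
  α.2.2 < 0 ∧
    ∑ m, (∫ ξ : ℝ, dvdExp α (l m) ξ) = r.1 ∧
    ∑ m, (∫ ξ : ℝ, ξ * dvdExp α (l m) ξ) • l m = r.2.1 ∧
    ∑ m, (∫ ξ : ℝ, ξ ^ 2 / 2 * dvdExp α (l m) ξ) = r.2.2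

/-- A solution `α` of the equilibrium equations for the macroscopic state `r`. -/
def equilibriumParameter {D N : ℕ} (l : Fin N → EuclideanSpace ℝ (Fin D))
    (r : ℝ × EuclideanSpace ℝ (Fin D) × ℝ) : ℝ × EuclideanSpace ℝ (Fin D) × ℝ :=
  Classical.epsilon (IsEquilibriumParameter l r)

/-- The common variance `σ² = -1 / α_{D+1}` of the equilibrium Gaussians. -/
def equilibriumVariance {D : ℕ} (α : ℝ × EuclideanSpace ℝ (Fin D) × ℝ) : ℝ :=
  -1 / α.2.2

/-- The center `u_m = l_m · (σ² \hat α)` of the equilibrium Gaussian in direction `l_m`. -/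
def equilibriumCenter {D : ℕ} (α : ℝ × EuclideanSpace ℝ (Fin D) × ℝ)
    (l : EuclideanSpace ℝ (Fin D)) : ℝ :=
  inner ℝ l (equilibriumVariance α • α.2.1)

/-- The mass `ρ_m = √(2π) σ exp (α_0 + u_m² / (2 σ²))` of the equilibrium Gaussian in
direction `l_m`. -/
def equilibriumMass {D : ℕ} (α : ℝ × EuclideanSpace ℝ (Fin D) × ℝ)
    (l : EuclideanSpace ℝ (Fin D)) : ℝ :=
  Real.sqrt (2 * Real.pi) * Real.sqrt (equilibriumVariance α) *
    Real.exp (α.1 + equilibriumCenter α l ^ 2 / (2 * equilibriumVariance α))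

/-! ## The DVD-EQMOM moment system -/

/-- Index set of the unknown `𝓜 = (M_1, …, M_N)`, where `M_m = (M_{m,0}, …, M_{m, 2 n_m})`. -/
abbrev DvdIndex {N : ℕ} (n : Fin N → ℕ) : Type := Σ m : Fin N, Fin (2 * n m + 1)

/-- The block `M_m` of the unknown `𝓜`. -/
def dvdBlock {N : ℕ} {n : Fin N → ℕ} (M : DvdIndex n → ℝ) (m : Fin N) :
    Fin (2 * n m + 1) → ℝ :=
  fun k => M ⟨m, k⟩

/-- The macroscopic state `(ρ, ρ U, ρ E) = (∑ M_{m,0}, ∑ M_{m,1} l_m, ∑ M_{m,2} / 2)`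
(meaningful if all `n m ≥ 1`). -/
def dvdMacroscopic {D N : ℕ} (l : Fin N → EuclideanSpace ℝ (Fin D)) {n : Fin N → ℕ}
    (M : DvdIndex n → ℝ) : ℝ × EuclideanSpace ℝ (Fin D) × ℝ :=
  (∑ m, dvdBlock M m 0, ∑ m, dvdBlock M m 1 • l m, ∑ m, dvdBlock M m 2 / 2)

/-- The equilibrium moments `M_{𝓔 m, k} = ρ_m Δ_k(u_m, σ²)`. -/
def dvdEquilibriumMoments {D N : ℕ} (l : Fin N → EuclideanSpace ℝ (Fin D)) {n : Fin N → ℕ}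
    (M : DvdIndex n → ℝ) : DvdIndex n → ℝ :=
  let α := equilibriumParameter l (dvdMacroscopic l M)
  fun p => equilibriumMass α (l p.1) *
    gaussianMoment p.2 (equilibriumCenter α (l p.1)) (equilibriumVariance α)

/-- The DVD-EQMOM moment system `∂_t 𝓜 + ∑ i, A⁽ⁱ⁾ ∂_{x_i} 𝓜 = (M_𝓔 - 𝓜) / τ` in `Dx ≤ D` space
variables, with velocity directions `l m` in `ℝ^D` and `n m` Gaussian nodes in direction `m`.
Here `A⁽ⁱ⁾ = diag {(l_1 · e_i) A_1(M_1), …, (l_N · e_i) A_N(M_N)}`. -/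
def dvdEqmomSystem {D Dx N : ℕ} (hD : Dx ≤ D) (τ : ℝ)
    (l : Fin N → EuclideanSpace ℝ (Fin D)) (n : Fin N → ℕ) :
    QuasilinearSystem Dx (DvdIndex n) where
  domain := {M | ∀ m, dvdBlock M m ∈ eqmomRealizable (n m)}
  coeff := fun i M => Matrix.blockDiagonal' fun m =>
    (l m (Fin.castLE hD i)) • eqmomMatrix (n m) (dvdBlock M m)
  source := fun M => (1 / τ) • (dvdEquilibriumMoments l M - M)

end

open Polynomial MeasureTheory Filter Topology

/-! ## The heat flow on polynomials -/

/-! The Gaussian average of a polynomial `q` with center `v` and variance `θ` is `(H_θ q)(v)`, where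
`H_θ = exp (θ ∂² / 2)` is invertible on polynomials of bounded degree, with inverse `H_{-θ}`.
Testing moments against `q = H_{-θ} p` therefore turns Gaussian sums into point evaluations at the
nodes, and variations of the parameters into values of `p`, `p'`, `p''` there, the last with
coefficients `w a * dθ / 2`. Let `P = ∏ (X - v a)`.

Closure: suitable multiples and divisors of `P` show that the moment map is an immersion between
spaces of dimension `2 n + 1`, so the inverse function theorem applies
(`eqmomClosure_local_structure`). Independence of the representation comes from testing with `H_{-θ}
(P²)`, which forces equal variances and common nodes.

Hyperbolicity: for `p = (X - b) P²` only `p''` survives at the nodes, and a suitable weighted mean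
`b` makes its total contribution vanish. Hence `c = H_{-θ} ((X - b) P²)`, monic of degree `2 n + 1`,
is killed by every tangent functional. This says that the gradient of the closure consists of minus
the lower coefficients of `c`, so the coefficient matrix is the companion matrix of `c`. The
backward flow `H_{-θ}` separates multiple real roots: adjoining a root `r` becomes `f ↦ (X - r) f -
θ f'`, a derivative of `f` times a Gaussian up to a nonvanishing factor, and Rolle's theorem on the
whole line yields one more simple root. Thus `c` has simple real roots and a Vandermonde matrix
diagonalizes. -/

/-- The operator `p ↦ X p + s p'` on real polynomials. -/
noncomputable def heatGenerator (s : ℝ) : Module.End ℝ ℝ[X] :=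
  LinearMap.mulLeft ℝ X + s • derivative

/-- The operator `exp (s ∂² / 2)` on real polynomials, normalized by `heatFlow s 1 = 1` and
`heatFlow s (X p) = X (heatFlow s p) + s (heatFlow s p)'`. -/
noncomputable def heatFlow (s : ℝ) : ℝ[X] →ₗ[ℝ] ℝ[X] :=
  LinearMap.applyₗ (1 : ℝ[X]) ∘ₗ (aeval (heatGenerator s)).toLinearMap

theorem heatFlow_one (s : ℝ) : heatFlow s 1 = 1 := by
  simp [heatFlow]

theorem heatFlow_X_mul (s : ℝ) (p : ℝ[X]) :
    heatFlow s (X * p) = X * heatFlow s p + s • derivative (heatFlow s p) := by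
  simp [heatFlow, heatGenerator]

/-- Adapted to the recursion `heatFlow_X_mul`: a linear identity for the flow needs checking only at
`1` and under multiplication by `X`. -/
theorem heatFlow_induction {motive : ℝ[X] → Prop} (one : motive 1)
    (add : ∀ p q, motive p → motive q → motive (p + q))
    (smul : ∀ (a : ℝ) p, motive p → motive (a • p))
    (X_mul : ∀ p, motive p → motive (X * p)) (p : ℝ[X]) : motive p := by
  have hX : ∀ k : ℕ, motive (X ^ k) := by
    intro k
    induction k with
    | zero => simpa using one
    | succ k ih => rw [pow_succ']; exact X_mul _ ih
  induction p using Polynomial.induction_on' with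
  | add p q hp hq => exact add p q hp hq
  | monomial k a =>
    rw [← C_mul_X_pow_eq_monomial, ← smul_eq_C_mul]
    exact smul _ _ (hX k)

theorem derivative_heatFlow (s : ℝ) (p : ℝ[X]) :
    derivative (heatFlow s p) = heatFlow s (derivative p) := by
  induction p using heatFlow_induction with
  | one => simp [heatFlow_one]
  | add p q hp hq => simp [hp, hq]
  | smul a p hp => simp [hp]
  | X_mul p hp =>
    rw [heatFlow_X_mul]
    simp only [derivative_mul, derivative_X, map_add, one_mul, heatFlow_X_mul, derivative_smul, hp]
    abel

theorem heatFlow_heatFlow (t s : ℝ) (p : ℝ[X]) :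
    heatFlow t (heatFlow s p) = heatFlow (t + s) p := by
  induction p using heatFlow_induction with
  | one => simp [heatFlow_one]
  | add p q hp hq => simp [hp, hq]
  | smul a p hp => simp [hp]
  | X_mul p hp =>
    rw [heatFlow_X_mul, map_add, heatFlow_X_mul, map_smul, ← derivative_heatFlow, hp,
      heatFlow_X_mul, add_smul]
    abel

theorem heatFlow_zero (p : ℝ[X]) : heatFlow 0 p = p := by
  induction p using heatFlow_induction with
  | one => simp [heatFlow_one]
  | add p q hp hq => simp [hp, hq]
  | smul a p hp => simp [hp]
  | X_mul p hp => simp [heatFlow_X_mul, hp]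

theorem heatFlow_heatFlow_neg (s : ℝ) (p : ℝ[X]) : heatFlow s (heatFlow (-s) p) = p := by
  rw [heatFlow_heatFlow, add_neg_cancel, heatFlow_zero]

theorem natDegree_heatFlow_X_pow_le (s : ℝ) (k : ℕ) : (heatFlow s (X ^ k)).natDegree ≤ k := by
  induction k with
  | zero => simp [heatFlow_one]
  | succ k ih =>
    rw [pow_succ', heatFlow_X_mul]
    refine natDegree_add_le_of_degree_le ?_ ?_
    · exact natDegree_mul_le.trans (by simp; omega)
    · exact (natDegree_smul_le _ _).trans ((natDegree_derivative_le _).trans (by omega))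

theorem natDegree_heatFlow_le (s : ℝ) {p : ℝ[X]} {m : ℕ} (hp : p.natDegree ≤ m) :
    (heatFlow s p).natDegree ≤ m := by
  rw [p.as_sum_range_C_mul_X_pow, map_sum]
  refine natDegree_sum_le_of_forall_le _ _ fun i hi => ?_
  rw [← smul_eq_C_mul, map_smul]
  have := natDegree_heatFlow_X_pow_le s i
  have := Finset.mem_range.mp hi
  exact (natDegree_smul_le _ _).trans (by omega)

/-- The heat equation `∂_s = ∂² / 2`. Strict differentiability is what the inverse function theorem
requires. -/
theorem hasStrictFDerivAt_eval_heatFlow (p : ℝ[X]) (u s : ℝ) :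
    HasStrictFDerivAt (fun x : ℝ × ℝ => (heatFlow x.2 p).eval x.1)
      ((derivative (heatFlow s p)).eval u • ContinuousLinearMap.fst ℝ ℝ ℝ +
        (1 / 2 * (derivative (derivative (heatFlow s p))).eval u) •
          ContinuousLinearMap.snd ℝ ℝ ℝ) (u, s) := by
  have key : ∀ k : ℕ, ∀ q : ℝ[X], q.natDegree ≤ k →
      HasStrictFDerivAt (fun x : ℝ × ℝ => (heatFlow x.2 q).eval x.1)
      ((derivative (heatFlow s q)).eval u • ContinuousLinearMap.fst ℝ ℝ ℝ +
        (1 / 2 * (derivative (derivative (heatFlow s q))).eval u) •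
          ContinuousLinearMap.snd ℝ ℝ ℝ) (u, s) := by
    intro k
    induction k with
    | zero =>
      intro q hq
      rw [eq_C_of_natDegree_le_zero hq]
      have h : ∀ t a : ℝ, heatFlow t (C a) = C a := fun t a => by
        rw [← mul_one (C a), ← smul_eq_C_mul, map_smul, heatFlow_one]
      simp only [h, eval_C, derivative_C, eval_zero, map_zero, mul_zero, zero_smul, add_zero]
      exact hasStrictFDerivAt_const _ _
    | succ k ih =>
      intro q hq
      -- The recursion for `X * r` involves both `r` and its derivative, hence induction on a degree
      -- bound.
      obtain ⟨r, a, rfl, hr⟩ : ∃ (r : ℝ[X]) (a : ℝ), X * r + C a = q ∧ r.natDegree ≤ k :=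
        ⟨q.divX, q.coeff 0, X_mul_divX_add q, by rw [natDegree_divX_eq_natDegree_tsub_one]; omega⟩
      have h : ∀ t a : ℝ, heatFlow t (C a) = C a := fun t a => by
        rw [← mul_one (C a), ← smul_eq_C_mul, map_smul, heatFlow_one]
      have h1 := ih r hr
      have h2 := ih (derivative r) ((natDegree_derivative_le r).trans (by omega))
      have h3 := ((hasStrictFDerivAt_fst (𝕜 := ℝ) (p := (u, s))).mul h1).add
        ((hasStrictFDerivAt_snd (𝕜 := ℝ) (p := (u, s))).mul h2) |>.add_const a
      have e : (fun x : ℝ × ℝ => (heatFlow x.2 (X * r + C a)).eval x.1) =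
          fun x : ℝ × ℝ => x.1 * (heatFlow x.2 r).eval x.1 +
            x.2 * (heatFlow x.2 (derivative r)).eval x.1 + a := by
        funext x
        simp [heatFlow_X_mul, h, derivative_heatFlow]
      rw [e]
      refine h3.congr_fderiv ?_
      ext <;> simp [heatFlow_X_mul, h, ← derivative_heatFlow] <;> ring
  exact key _ p le_rfl

/-! ## Gaussian integrals of polynomials -/

theorem integrable_polynomial_mul_gaussian (p : ℝ[X]) (u : ℝ) {s : ℝ} (hs : 0 < s) :
    Integrable fun ξ : ℝ => p.eval ξ * Real.exp (-(ξ - u) ^ 2 / (2 * s)) := by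
  have h : ∀ q : ℝ[X], Integrable fun ξ : ℝ => q.eval ξ * Real.exp (-(1 / (2 * s)) * ξ ^ 2) := by
    intro q
    induction q using Polynomial.induction_on' with
    | add p q hp hq =>
      simp only [eval_add, add_mul]
      exact hp.add hq
    | monomial k a =>
      have := (integrable_rpow_mul_exp_neg_mul_sq (b := 1 / (2 * s)) (by positivity)
        (s := k) (by have : (0 : ℝ) ≤ k := k.cast_nonneg
                     linarith)).const_mul a
      simpa [mul_assoc] using this
  have h1 := (h (p.comp (X + C u))).comp_sub_right u
  refine h1.congr (Eventually.of_forall fun ξ => ?_)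
  simp only [eval_comp, eval_add, eval_X, eval_C, sub_add_cancel]
  congr 2
  ring

theorem hasDerivAt_polynomial_mul_gaussian (p : ℝ[X]) (u : ℝ) {s : ℝ} (hs : s ≠ 0) (ξ : ℝ) :
    HasDerivAt (fun ξ : ℝ => p.eval ξ * Real.exp (-(ξ - u) ^ 2 / (2 * s)))
      ((derivative p - s⁻¹ • ((X - C u) * p)).eval ξ * Real.exp (-(ξ - u) ^ 2 / (2 * s))) ξ := by
  have h1 : HasDerivAt (fun ξ : ℝ => -(ξ - u) ^ 2 / (2 * s)) (-(s⁻¹ * (ξ - u))) ξ := by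
    have := ((((hasDerivAt_id ξ).sub_const u).pow 2).neg).div_const (2 * s)
    refine this.congr_deriv ?_
    simp
    field_simp
  refine ((p.hasDerivAt ξ).mul h1.exp).congr_deriv ?_
  simp
  ring

/-- The Gaussian expectation of a polynomial. -/
noncomputable def gaussianExpectation (u s : ℝ) (p : ℝ[X]) : ℝ :=
  ∫ ξ : ℝ, p.eval ξ * (1 / Real.sqrt (2 * Real.pi * s) * Real.exp (-(ξ - u) ^ 2 / (2 * s)))

theorem gaussianExpectation_eq (u s : ℝ) (p : ℝ[X]) :
    gaussianExpectation u s p = 1 / Real.sqrt (2 * Real.pi * s) *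
      ∫ ξ : ℝ, p.eval ξ * Real.exp (-(ξ - u) ^ 2 / (2 * s)) := by
  rw [gaussianExpectation, ← integral_const_mul]
  congr 1 with ξ
  ring

theorem gaussianExpectation_add (u : ℝ) {s : ℝ} (hs : 0 < s) (p q : ℝ[X]) :
    gaussianExpectation u s (p + q) = gaussianExpectation u s p + gaussianExpectation u s q := by
  simp only [gaussianExpectation_eq, eval_add, add_mul]
  rw [integral_add (integrable_polynomial_mul_gaussian p u hs)
    (integrable_polynomial_mul_gaussian q u hs)]
  ring

theorem gaussianExpectation_smul (u s a : ℝ) (p : ℝ[X]) :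
    gaussianExpectation u s (a • p) = a * gaussianExpectation u s p := by
  simp only [gaussianExpectation_eq, eval_smul, smul_eq_mul, mul_assoc]
  rw [integral_const_mul]
  ring

theorem gaussianExpectation_one (u : ℝ) {s : ℝ} (hs : 0 < s) : gaussianExpectation u s 1 = 1 := by
  rw [gaussianExpectation_eq]
  have h := integral_sub_right_eq_self (fun ξ : ℝ => Real.exp (-(1 / (2 * s)) * ξ ^ 2)) u
    (μ := volume)
  rw [integral_gaussian] at h
  have e : ∀ ξ : ℝ, (1 : ℝ[X]).eval ξ * Real.exp (-(ξ - u) ^ 2 / (2 * s)) =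
      Real.exp (-(1 / (2 * s)) * (ξ - u) ^ 2) := fun ξ => by
    simp only [eval_one, one_mul]
    congr 1
    ring
  simp only [e, h]
  have : Real.pi / (1 / (2 * s)) = 2 * Real.pi * s := by field_simp
  rw [this]
  have : 0 < Real.sqrt (2 * Real.pi * s) := by positivity
  field_simp

/-- Gaussian integration by parts. -/
theorem gaussianExpectation_X_mul (u : ℝ) {s : ℝ} (hs : 0 < s) (p : ℝ[X]) :
    gaussianExpectation u s (X * p) =
      u * gaussianExpectation u s p + s * gaussianExpectation u s (derivative p) := by
  have h := integral_eq_zero_of_hasDerivAt_of_integrable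
    (hasDerivAt_polynomial_mul_gaussian p u hs.ne')
    (integrable_polynomial_mul_gaussian _ u hs) (integrable_polynomial_mul_gaussian p u hs)
  have h0 : gaussianExpectation u s (derivative p - s⁻¹ • ((X - C u) * p)) = 0 := by
    rw [gaussianExpectation_eq, h, mul_zero]
  have e : X * p = s • derivative p + (u • p + (-s) • (derivative p - s⁻¹ • ((X - C u) * p))) := by
    rw [smul_sub, smul_smul, neg_mul, mul_inv_cancel₀ hs.ne', smul_eq_C_mul u]
    simp only [neg_smul, one_smul]
    ring
  rw [e, gaussianExpectation_add u hs, gaussianExpectation_add u hs, gaussianExpectation_smul,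
    gaussianExpectation_smul, gaussianExpectation_smul, h0]
  ring

/-- Integration by parts gives Gaussian averages the same recursion under multiplication by `X` as
the heat flow. -/
theorem gaussianExpectation_eq_eval_heatFlow (u : ℝ) {s : ℝ} (hs : 0 < s) (p : ℝ[X]) :
    gaussianExpectation u s p = (heatFlow s p).eval u := by
  have key : ∀ k : ℕ, ∀ q : ℝ[X], q.natDegree ≤ k →
      gaussianExpectation u s q = (heatFlow s q).eval u := by
    intro k
    have hC : ∀ a : ℝ, gaussianExpectation u s (C a) = (heatFlow s (C a)).eval u := fun a => by
      rw [← mul_one (C a), ← smul_eq_C_mul, gaussianExpectation_smul, gaussianExpectation_one u hs,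
        map_smul, heatFlow_one]
      simp
    induction k with
    | zero =>
      intro q hq
      rw [eq_C_of_natDegree_le_zero hq, hC]
    | succ k ih =>
      intro q hq
      rw [← X_mul_divX_add q, gaussianExpectation_add u hs, gaussianExpectation_X_mul u hs, hC,
        ih, ih, map_add, heatFlow_X_mul, derivative_heatFlow]
      · simp
      · exact (natDegree_derivative_le _).trans
          (by rw [natDegree_divX_eq_natDegree_tsub_one]; omega)
      · rw [natDegree_divX_eq_natDegree_tsub_one]; omega
  exact key _ p le_rfl

theorem gaussianMoment_eq_eval_heatFlow (k : ℕ) (u : ℝ) {s : ℝ} (hs : 0 < s) :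
    gaussianMoment k u s = (heatFlow s (X ^ k)).eval u := by
  rw [← gaussianExpectation_eq_eval_heatFlow u hs]
  simp [gaussianMoment, gaussianExpectation]

theorem eval_heatFlow_pos (u : ℝ) {s : ℝ} (hs : 0 < s) {p : ℝ[X]} (hp : p ≠ 0)
    (hnn : ∀ ξ, 0 ≤ p.eval ξ) : 0 < (heatFlow s p).eval u := by
  rw [← gaussianExpectation_eq_eval_heatFlow u hs, gaussianExpectation_eq]
  refine mul_pos (by positivity) ?_
  rw [integral_pos_iff_support_of_nonneg
    (fun ξ => mul_nonneg (hnn ξ) (Real.exp_pos _).le) (integrable_polynomial_mul_gaussian p u hs)]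
  have : (Function.support fun ξ : ℝ => p.eval ξ * Real.exp (-(ξ - u) ^ 2 / (2 * s))) =
      {ξ | p.eval ξ ≠ 0} := by
    ext ξ
    simp [Real.exp_ne_zero]
  rw [this]
  refine (isOpen_ne_fun p.continuous continuous_const).measure_pos _ ?_
  by_contra h
  rw [Set.not_nonempty_iff_eq_empty] at h
  refine hp (Polynomial.funext fun ξ => ?_)
  by_contra hξ
  exact (h ▸ (show ξ ∈ {ξ | p.eval ξ ≠ 0} from by simpa using hξ) : ξ ∈ (∅ : Set ℝ))

/-! ## Real roots under the backward heat flow -/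

/-- Rolle's theorem on a half-line: `t ↦ a - 1 + t⁻¹` carries `(0, 1)` onto `(a, ∞)`. -/
theorem exists_hasDerivAt_eq_zero_of_tendsto_atTop {f f' : ℝ → ℝ} {a l : ℝ}
    (hd : ∀ x, HasDerivAt f (f' x) x) (hfa : f a = l) (hf : Tendsto f atTop (𝓝 l)) :
    ∃ c, a < c ∧ f' c = 0 := by
  have hg : ∀ t ∈ Set.Ioo (0 : ℝ) 1, HasDerivAt (fun t : ℝ => f (a - 1 + t⁻¹))
      (f' (a - 1 + t⁻¹) * -(t ^ 2)⁻¹) t := fun t ht =>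
    (hd _).comp t ((hasDerivAt_inv ht.1.ne').const_add (a - 1))
  have h0 : Tendsto (fun t : ℝ => f (a - 1 + t⁻¹)) (𝓝[>] 0) (𝓝 l) :=
    hf.comp (tendsto_atTop_add_const_left _ _ tendsto_inv_nhdsGT_zero)
  have h1 : Tendsto (fun t : ℝ => f (a - 1 + t⁻¹)) (𝓝[<] 1) (𝓝 l) := by
    have hc : ContinuousAt (fun t : ℝ => f (a - 1 + t⁻¹)) 1 :=
      ContinuousAt.comp (hd _).continuousAt
        (continuousAt_const.add (continuousAt_inv₀ one_ne_zero))
    have := hc.tendsto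
    simp only [inv_one, sub_add_cancel, hfa] at this
    exact this.mono_left nhdsWithin_le_nhds
  obtain ⟨c, hc, hc0⟩ := exists_hasDerivAt_eq_zero' one_pos h0 h1 hg
  refine ⟨a - 1 + c⁻¹, ?_, ?_⟩
  · have := (one_lt_inv₀ hc.1).mpr hc.2
    linarith
  · refine (mul_eq_zero.mp hc0).resolve_right ?_
    have := hc.1.ne'
    simpa using this

theorem exists_hasDerivAt_eq_zero_of_tendsto_atBot {f f' : ℝ → ℝ} {a l : ℝ}
    (hd : ∀ x, HasDerivAt f (f' x) x) (hfa : f a = l) (hf : Tendsto f atBot (𝓝 l)) :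
    ∃ c, c < a ∧ f' c = 0 := by
  have hg : ∀ x, HasDerivAt (fun x => f (-x)) (-f' (-x)) x := fun x =>
    ((hd (-x)).comp x (hasDerivAt_neg x)).congr_deriv (by simp)
  obtain ⟨c, hc, hc0⟩ := exists_hasDerivAt_eq_zero_of_tendsto_atTop (a := -a) hg (by simpa using hfa)
    (hf.comp tendsto_neg_atTop_atBot)
  exact ⟨-c, by linarith, by simpa using hc0⟩

/-- The operator `f ↦ (X - r) f - s f'`, `s > 0`, raises the number of simple real roots of a
polynomial with only such roots by one. -/
theorem exists_strictMono_roots_sub_smul_derivative {k : ℕ} {f : ℝ[X]} {x : Fin k → ℝ}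
    (hf : f.natDegree = k) (hm : f.Monic) (hx : StrictMono x) (hroot : ∀ i, f.eval (x i) = 0)
    (r : ℝ) {s : ℝ} (hs : 0 < s) :
    ∃ y : Fin (k + 1) → ℝ, StrictMono y ∧
      ∀ j, ((X - C r) * f - s • derivative f).eval (y j) = 0 := by
  set g := (X - C r) * f - s • derivative f with hg
  -- The derivative of `φ` is `-s⁻¹ * g` times the Gaussian factor, so the critical points of `φ`
  -- are roots of `g`.
  set φ : ℝ → ℝ := fun ξ => f.eval ξ * Real.exp (-(ξ - r) ^ 2 / (2 * s)) with hφ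
  have hd := hasDerivAt_polynomial_mul_gaussian f r hs.ne'
  have hg0 : ∀ ξ, (derivative f - s⁻¹ • ((X - C r) * f)).eval ξ *
      Real.exp (-(ξ - r) ^ 2 / (2 * s)) = 0 → g.eval ξ = 0 := by
    intro ξ h
    have h1 := (mul_eq_zero.mp h).resolve_right (Real.exp_ne_zero _)
    have h2 : g = (-s) • (derivative f - s⁻¹ • ((X - C r) * f)) := by
      rw [smul_sub, smul_smul, neg_mul, mul_inv_cancel₀ hs.ne', hg]
      simp only [neg_smul, one_smul]
      ring
    rw [h2, eval_smul, h1, smul_zero]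
  have hφ0 : ∀ i, φ (x i) = 0 := fun i => by simp [hφ, hroot i]
  have hi := integrable_polynomial_mul_gaussian f r hs
  have hi' := integrable_polynomial_mul_gaussian (derivative f - s⁻¹ • ((X - C r) * f)) r hs
  -- Integrability of `φ` and `φ'` forces decay, so `±∞` act as two further zeros of `φ`.
  have htop : Tendsto φ atTop (𝓝 0) :=
    tendsto_zero_of_hasDerivAt_of_integrableOn_Ioi (a := 0) (fun ξ _ => hd ξ)
      hi'.integrableOn hi.integrableOn
  have hbot : Tendsto φ atBot (𝓝 0) :=
    tendsto_zero_of_hasDerivAt_of_integrableOn_Iic (a := 0) (fun ξ _ => hd ξ)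
      hi'.integrableOn hi.integrableOn
  -- The zeros `x i` cut the line into `k + 1` gaps, and Rolle puts a critical point in each.
  -- Recording the gap yields strict monotonicity. For `k = 0` no zero is available, but then `g = X
  -- - r`.
  have key : ∀ j : Fin (k + 1), ∃ y, g.eval y = 0 ∧ (∀ i : Fin k, i.castSucc < j → x i < y) ∧
      ∀ i : Fin k, j ≤ i.castSucc → y < x i := by
    intro j
    rcases Nat.eq_zero_or_pos k with rfl | hk
    · refine ⟨r, ?_, fun i => i.elim0, fun i => i.elim0⟩
      rw [eq_one_of_monic_natDegree_zero hm hf] at hg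
      simp [hg]
    rcases Nat.eq_zero_or_pos (j : ℕ) with hj | hj
    · obtain ⟨c, hc, hc0⟩ := exists_hasDerivAt_eq_zero_of_tendsto_atBot hd (hφ0 ⟨0, hk⟩) hbot
      refine ⟨c, hg0 c hc0, fun i hij => ?_, fun i _ => hc.trans_le (hx.monotone (Nat.zero_le _))⟩
      rw [Fin.lt_def] at hij
      omega
    have hj' := j.isLt
    rcases Nat.lt_or_ge (j : ℕ) k with hjk | hjk
    · obtain ⟨c, hc, hc0⟩ := exists_hasDerivAt_eq_zero
        (f := φ) (a := x ⟨j - 1, by omega⟩) (b := x ⟨j, hjk⟩)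
        (hx (by rw [Fin.lt_def]; simp only; omega))
        (fun ξ _ => (hd ξ).continuousAt.continuousWithinAt) ((hφ0 _).trans (hφ0 _).symm)
        (fun ξ _ => hd ξ)
      refine ⟨c, hg0 c hc0, fun i hij => ?_, fun i hij => ?_⟩
      · refine lt_of_le_of_lt (hx.monotone ?_) hc.1
        rw [Fin.lt_def] at hij
        rw [Fin.le_def]
        simp only [Fin.val_castSucc] at hij ⊢
        omega
      · exact lt_of_lt_of_le hc.2 (hx.monotone hij)
    · obtain ⟨c, hc, hc0⟩ := exists_hasDerivAt_eq_zero_of_tendsto_atTop hd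
        (hφ0 ⟨k - 1, by omega⟩) htop
      refine ⟨c, hg0 c hc0, fun i _ => lt_of_le_of_lt (hx.monotone ?_) hc, fun i hij => ?_⟩
      · rw [Fin.le_def]
        simp only
        omega
      · rw [Fin.le_def] at hij
        simp only [Fin.val_castSucc] at hij
        omega
  choose y hy0 hlt hgt using key
  refine ⟨y, fun j j' hjj => ?_, hy0⟩
  have hj : (j : ℕ) < k := by
    have := j'.isLt
    rw [Fin.lt_def] at hjj
    omega
  exact (hgt j ⟨j, hj⟩ le_rfl).trans (hlt j' ⟨j, hj⟩ hjj)

/-- For `s > 0` the operator `exp (-s ∂² / 2)` maps real-rooted monic polynomials to monic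
polynomials with simple real roots. -/
theorem exists_strictMono_roots_heatFlow_neg {s : ℝ} (hs : 0 < s) (R : Multiset ℝ) :
    (heatFlow (-s) (R.map fun r => X - C r).prod).natDegree = R.card ∧
    (heatFlow (-s) (R.map fun r => X - C r).prod).Monic ∧
    ∃ y : Fin R.card → ℝ, StrictMono y ∧
      ∀ j, (heatFlow (-s) (R.map fun r => X - C r).prod).eval (y j) = 0 := by
  induction R using Multiset.induction_on with
  | empty =>
    simp only [Multiset.map_zero, Multiset.prod_zero, heatFlow_one, natDegree_one,
      Multiset.card_zero, monic_one, true_and]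
    exact ⟨fun i => i.elim0, fun i => i.elim0, fun i => i.elim0⟩
  | cons r R ih =>
    obtain ⟨hdeg, hm, y, hy, hroot⟩ := ih
    set f := heatFlow (-s) (R.map fun r => X - C r).prod with hf
    have hstep : heatFlow (-s) ((r ::ₘ R).map fun r => X - C r).prod =
        (X - C r) * f - s • derivative f := by
      rw [Multiset.map_cons, Multiset.prod_cons, sub_mul, map_sub, heatFlow_X_mul,
        ← smul_eq_C_mul, map_smul, sub_mul, ← smul_eq_C_mul, ← hf, neg_smul]
      ring
    have hmon : ((X - C r) * f).Monic := (monic_X_sub_C r).mul hm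
    have hnd : ((X - C r) * f).natDegree = R.card + 1 := by
      rw [(monic_X_sub_C r).natDegree_mul hm, natDegree_X_sub_C, hdeg, add_comm]
    have hlt : (s • derivative f).natDegree < ((X - C r) * f).natDegree := by
      rw [hnd, ← hdeg]
      have := natDegree_derivative_le f
      exact lt_of_le_of_lt ((natDegree_smul_le _ _).trans this) (by omega)
    rw [hstep, Multiset.card_cons]
    refine ⟨?_, ?_, exists_strictMono_roots_sub_smul_derivative hdeg hm hy hroot r hs⟩
    · rw [natDegree_sub_eq_left_of_natDegree_lt hlt, hnd]
    · exact hmon.sub_of_left (degree_lt_degree hlt)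

theorem exists_strictMono_roots_heatFlow_neg_mul_nodal_sq {s : ℝ} (hs : 0 < s) {n : ℕ}
    (v : Fin n → ℝ) (b : ℝ) :
    (heatFlow (-s) ((X - C b) * Lagrange.nodal Finset.univ v ^ 2)).natDegree = 2 * n + 1 ∧
    (heatFlow (-s) ((X - C b) * Lagrange.nodal Finset.univ v ^ 2)).Monic ∧
    ∃ y : Fin (2 * n + 1) → ℝ, StrictMono y ∧ ∀ j,
      (heatFlow (-s) ((X - C b) * Lagrange.nodal Finset.univ v ^ 2)).eval (y j) = 0 := by
  set R : Multiset ℝ := b ::ₘ ((Finset.univ : Finset (Fin n)).val.map v +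
    (Finset.univ : Finset (Fin n)).val.map v) with hR
  have hcard : R.card = 2 * n + 1 := by
    simp [hR]
    omega
  have hprod : (R.map fun r => X - C r).prod = (X - C b) * Lagrange.nodal Finset.univ v ^ 2 := by
    rw [hR, Multiset.map_cons, Multiset.prod_cons, Multiset.map_add, Multiset.prod_add,
      Multiset.map_map, sq]
    rfl
  rw [← hcard, ← hprod]
  exact exists_strictMono_roots_heatFlow_neg hs R

/-! ## Linear functionals on polynomials -/

theorem linearMap_eq_of_natDegree_le {E : Type*} [AddCommGroup E] [Module ℝ E]
    {L L' : ℝ[X] →ₗ[ℝ] E} {m : ℕ} (h : ∀ k ≤ m, L (X ^ k) = L' (X ^ k)) {p : ℝ[X]}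
    (hp : p.natDegree ≤ m) : L p = L' p := by
  rw [p.as_sum_range_C_mul_X_pow, map_sum, map_sum]
  refine Finset.sum_congr rfl fun i hi => ?_
  have := Finset.mem_range.mp hi
  rw [← smul_eq_C_mul, map_smul, map_smul, h i (by omega)]

/-- An annihilated monic polynomial expresses the top moment through the lower ones; this serves
both uniqueness of the closure and its gradient. -/
theorem linearMap_X_pow_eq_of_monic {E : Type*} [AddCommGroup E] [Module ℝ E]
    (L : ℝ[X] →ₗ[ℝ] E) {p : ℝ[X]} (hp : p.Monic) {m : ℕ} (hm : p.natDegree = m) (h0 : L p = 0) :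
    L (X ^ m) = -∑ i : Fin m, p.coeff i • L (X ^ (i : ℕ)) := by
  rw [hp.as_sum, hm, map_add, map_sum] at h0
  rw [eq_neg_of_add_eq_zero_left h0, ← Finset.sum_range fun i => p.coeff i • L (X ^ i)]
  simp [← smul_eq_C_mul]

/-- The functional `p ↦ ∑ a, w a • (exp (θ ∂² / 2) p) (v a)`. -/
noncomputable def momentFunctional {n : ℕ} (w v : Fin n → ℝ) (θ : ℝ) : ℝ[X] →ₗ[ℝ] ℝ :=
  ∑ a, w a • (leval (v a) ∘ₗ heatFlow θ)

theorem momentFunctional_apply {n : ℕ} (w v : Fin n → ℝ) (θ : ℝ) (p : ℝ[X]) :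
    momentFunctional w v θ p = ∑ a, w a * (heatFlow θ p).eval (v a) := by
  simp [momentFunctional, leval]

theorem eqmomMoment_eq_momentFunctional {n : ℕ} (w v : Fin n → ℝ) {θ : ℝ} (hθ : 0 < θ) (k : ℕ) :
    eqmomMoment w v θ k = momentFunctional w v θ (X ^ k) := by
  simp [eqmomMoment, momentFunctional_apply, gaussianMoment_eq_eval_heatFlow k _ hθ]

/-! ## Uniqueness of the reconstructed moment -/

theorem natDegree_nodal_sq {n : ℕ} (v : Fin n → ℝ) :
    (Lagrange.nodal Finset.univ v ^ 2).natDegree = 2 * n := by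
  simp [natDegree_pow, Lagrange.natDegree_nodal]

theorem eqmomMomentVector_eq_iff {n : ℕ} {w v w' v' : Fin n → ℝ} {θ θ' : ℝ} (hθ : 0 < θ)
    (hθ' : 0 < θ') :
    eqmomMomentVector w v θ = eqmomMomentVector w' v' θ' ↔ ∀ p : ℝ[X], p.natDegree ≤ 2 * n →
      momentFunctional w v θ p = momentFunctional w' v' θ' p := by
  constructor
  · intro h p hp
    refine linearMap_eq_of_natDegree_le (fun k hk => ?_) hp
    have := congrFun h ⟨k, by omega⟩
    simpa [eqmomMomentVector, eqmomMoment_eq_momentFunctional, hθ, hθ'] using this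
  · intro h
    funext k
    have := k.isLt
    simp only [eqmomMomentVector, eqmomMoment_eq_momentFunctional, hθ, hθ']
    exact h _ (by rw [natDegree_X_pow]; omega)

/-- Test with `H_{-θ} (P²)`: one side vanishes because `P` is zero at the nodes `v`. If `θ < θ'`,
the other is a positive combination of values of `H_{θ' - θ} (P²)`, which are strictly positive. -/
theorem variance_le_of_eqmomMomentVector_eq {n : ℕ} (hn : 1 ≤ n) {w v w' v' : Fin n → ℝ}
    {θ θ' : ℝ} (h : EqmomAdmissible w v θ) (h' : EqmomAdmissible w' v' θ')
    (heq : eqmomMomentVector w v θ = eqmomMomentVector w' v' θ') : θ' ≤ θ := by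
  by_contra hlt
  push Not at hlt
  set P := Lagrange.nodal Finset.univ v
  have h1 := (eqmomMomentVector_eq_iff h.variance_pos h'.variance_pos).mp heq
    (heatFlow (-θ) (P ^ 2)) (natDegree_heatFlow_le _ (natDegree_nodal_sq v).le)
  simp only [momentFunctional_apply, heatFlow_heatFlow_neg] at h1
  rw [heatFlow_heatFlow, Finset.sum_eq_zero] at h1
  · refine h1.not_lt (Finset.sum_pos (fun a _ => mul_pos (h'.weight_pos a) ?_) ⟨⟨0, hn⟩, by simp⟩)
    refine eval_heatFlow_pos _ (by linarith) (pow_ne_zero 2 Lagrange.nodal_ne_zero) fun ξ => ?_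
    rw [eval_pow]
    positivity
  · intro a _
    simp [P, Lagrange.eval_nodal_at_node]

/-- The first `2 n + 1` moments of a Gaussian sum determine the next one. -/
theorem eqmomMoment_eq_of_eqmomMomentVector_eq {n : ℕ} (hn : 1 ≤ n) {w v w' v' : Fin n → ℝ}
    {θ θ' : ℝ} (h : EqmomAdmissible w v θ) (h' : EqmomAdmissible w' v' θ')
    (heq : eqmomMomentVector w v θ = eqmomMomentVector w' v' θ') :
    eqmomMoment w v θ (2 * n + 1) = eqmomMoment w' v' θ' (2 * n + 1) := by
  obtain rfl : θ = θ' := le_antisymm (variance_le_of_eqmomMomentVector_eq hn h' h heq.symm)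
    (variance_le_of_eqmomMomentVector_eq hn h h' heq)
  have hθ := h.variance_pos
  have hL := (eqmomMomentVector_eq_iff hθ hθ).mp heq
  set P := Lagrange.nodal Finset.univ v
  have hv : ∀ a, P.eval (v a) = 0 := fun a => Lagrange.eval_nodal_at_node (Finset.mem_univ a)
  -- With equal variances the same test gives `∑ w' a * P (v' a)² = 0`, so every `v' a` is a root of
  -- `P`.
  have hv' : ∀ a, P.eval (v' a) = 0 := by
    have h1 := hL (heatFlow (-θ) (P ^ 2)) (natDegree_heatFlow_le _ (natDegree_nodal_sq v).le)
    simp only [momentFunctional_apply, heatFlow_heatFlow_neg, eval_pow, hv] at h1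
    simp only [ne_eq, OfNat.ofNat_ne_zero, not_false_eq_true, zero_pow, mul_zero,
      Finset.sum_const_zero] at h1
    rw [eq_comm, Finset.sum_eq_zero_iff_of_nonneg
      fun a _ => mul_nonneg (h'.weight_pos a).le (sq_nonneg _)] at h1
    intro a
    simpa [(h'.weight_pos a).ne'] using h1 a (Finset.mem_univ a)
  -- Only monicity and the degree matter here, so the extra root `0` is an arbitrary choice.
  obtain ⟨hdeg, hm, -⟩ := exists_strictMono_roots_heatFlow_neg_mul_nodal_sq hθ v 0
  have hz : momentFunctional w v θ (heatFlow (-θ) ((X - C 0) * P ^ 2)) = 0 := by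
    simp [momentFunctional_apply, heatFlow_heatFlow_neg, hv]
  have hz' : momentFunctional w' v' θ (heatFlow (-θ) ((X - C 0) * P ^ 2)) = 0 := by
    simp [momentFunctional_apply, heatFlow_heatFlow_neg, hv']
  rw [eqmomMoment_eq_momentFunctional _ _ hθ, eqmomMoment_eq_momentFunctional _ _ hθ,
    linearMap_X_pow_eq_of_monic _ hm hdeg hz, linearMap_X_pow_eq_of_monic _ hm hdeg hz']
  refine congrArg Neg.neg (Finset.sum_congr rfl fun i _ => ?_)
  rw [hL _ (by rw [natDegree_X_pow]; omega)]

theorem eqmomClosure_eqmomMomentVector {n : ℕ} (hn : 1 ≤ n) {w v : Fin n → ℝ} {θ : ℝ}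
    (h : EqmomAdmissible w v θ) :
    eqmomClosure n (eqmomMomentVector w v θ) = eqmomMoment w v θ (2 * n + 1) := by
  have hex : ∃ p : (Fin n → ℝ) × (Fin n → ℝ) × ℝ, EqmomAdmissible p.1 p.2.1 p.2.2 ∧
      eqmomMomentVector p.1 p.2.1 p.2.2 = eqmomMomentVector w v θ := ⟨(w, v, θ), h, rfl⟩
  rw [eqmomClosure, dif_pos hex]
  exact eqmomMoment_eq_of_eqmomMomentVector_eq hn hex.choose_spec.1 h hex.choose_spec.2

/-! ## The moment map and its inverse -/

/-- The derivative of `momentFunctional w v θ` in the direction `(dw, dv, dθ)`. -/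
noncomputable def tangentFunctional {n : ℕ} (p d : (Fin n → ℝ) × (Fin n → ℝ) × ℝ) :
    ℝ[X] →ₗ[ℝ] ℝ :=
  (∑ a, (d.1 a • leval (p.2.1 a) + (p.1 a * d.2.1 a) • leval (p.2.1 a) ∘ₗ derivative +
    (p.1 a * (1 / 2 * d.2.2)) • leval (p.2.1 a) ∘ₗ derivative ∘ₗ derivative)) ∘ₗ heatFlow p.2.2

theorem tangentFunctional_apply {n : ℕ} (p d : (Fin n → ℝ) × (Fin n → ℝ) × ℝ) (q : ℝ[X]) :
    tangentFunctional p d q = ∑ a, (d.1 a * (heatFlow p.2.2 q).eval (p.2.1 a) +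
      p.1 a * d.2.1 a * (derivative (heatFlow p.2.2 q)).eval (p.2.1 a) +
      p.1 a * (1 / 2 * d.2.2) *
        (derivative (derivative (heatFlow p.2.2 q))).eval (p.2.1 a)) := by
  simp [tangentFunctional, leval]

theorem exists_hasStrictFDerivAt_momentFunctional {n : ℕ} (p : (Fin n → ℝ) × (Fin n → ℝ) × ℝ)
    (q : ℝ[X]) :
    ∃ F' : ((Fin n → ℝ) × (Fin n → ℝ) × ℝ) →L[ℝ] ℝ,
      HasStrictFDerivAt (fun x : (Fin n → ℝ) × (Fin n → ℝ) × ℝ =>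
        momentFunctional x.1 x.2.1 x.2.2 q) F' p ∧ ∀ d, F' d = tangentFunctional p d q := by
  let W : Fin n → ((Fin n → ℝ) × (Fin n → ℝ) × ℝ) →L[ℝ] ℝ := fun a =>
    (ContinuousLinearMap.proj a).comp (ContinuousLinearMap.fst ℝ _ _)
  let Y : Fin n → ((Fin n → ℝ) × (Fin n → ℝ) × ℝ) →L[ℝ] ℝ × ℝ := fun a =>
    ((ContinuousLinearMap.proj a).prodMap (ContinuousLinearMap.id ℝ ℝ)).comp
      (ContinuousLinearMap.snd ℝ _ _)
  have h : ∀ a, HasStrictFDerivAt (fun x : (Fin n → ℝ) × (Fin n → ℝ) × ℝ =>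
      x.1 a * (heatFlow x.2.2 q).eval (x.2.1 a)) _ p := fun a =>
    (W a).hasStrictFDerivAt.mul
      ((hasStrictFDerivAt_eval_heatFlow q (p.2.1 a) p.2.2).comp p (Y a).hasStrictFDerivAt)
  refine ⟨_, (HasStrictFDerivAt.fun_sum fun a (_ : a ∈ Finset.univ) => h a).congr_of_eventuallyEq
    (Eventually.of_forall fun x => (momentFunctional_apply x.1 x.2.1 x.2.2 q).symm), fun d => ?_⟩
  rw [tangentFunctional_apply, sum_apply]
  refine Finset.sum_congr rfl fun a _ => ?_
  simp [W, Y]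
  ring

theorem eval_derivative_nodal_ne_zero {n : ℕ} {v : Fin n → ℝ} (hv : Function.Injective v)
    (a : Fin n) : (derivative (Lagrange.nodal Finset.univ v)).eval (v a) ≠ 0 := by
  rw [Lagrange.eval_nodal_derivative_eval_node_eq (Finset.mem_univ a), Lagrange.eval_nodal]
  refine Finset.prod_ne_zero_iff.mpr fun b hb => sub_ne_zero.mpr fun h => ?_
  exact (Finset.mem_erase.mp hb).1 (hv h).symm

/-- The moment map is an immersion at nondegenerate parameters. -/
theorem eq_zero_of_tangentFunctional_eq_zero {n : ℕ} (hn : 1 ≤ n)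
    {p d : (Fin n → ℝ) × (Fin n → ℝ) × ℝ} (hp : EqmomAdmissible p.1 p.2.1 p.2.2)
    (h : ∀ q : ℝ[X], q.natDegree ≤ 2 * n → tangentFunctional p d q = 0) : d = 0 := by
  obtain ⟨w, v, θ⟩ := p
  obtain ⟨dw, dv, dθ⟩ := d
  have hw := hp.weight_pos
  have hv := hp.node_injective
  set P := Lagrange.nodal Finset.univ v with hP
  simp only at hw hv
  have hT : ∀ q : ℝ[X], q.natDegree ≤ 2 * n →
      ∑ a, (dw a * q.eval (v a) + w a * dv a * (derivative q).eval (v a) +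
        w a * (1 / 2 * dθ) * (derivative (derivative q)).eval (v a)) = 0 := fun q hq => by
    have := h (heatFlow (-θ) q) (natDegree_heatFlow_le _ hq)
    simpa only [tangentFunctional_apply, heatFlow_heatFlow_neg] using this
  have hPv : ∀ a, P.eval (v a) = 0 := fun a => Lagrange.eval_nodal_at_node (Finset.mem_univ a)
  -- At each node `P²` and its first derivative vanish while its second derivative is `2 P'²`, which
  -- isolates `dθ`.
  have hθ : dθ = 0 := by
    have h1 := hT (P ^ 2) (natDegree_nodal_sq v).le
    have h2 : ∀ a, dw a * (P ^ 2).eval (v a) + w a * dv a * (derivative (P ^ 2)).eval (v a) +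
        w a * (1 / 2 * dθ) * (derivative (derivative (P ^ 2))).eval (v a) =
        dθ * (w a * (derivative P).eval (v a) ^ 2) := fun a => by
      simp [sq, hPv]
      ring
    simp only [h2, ← Finset.mul_sum] at h1
    refine (mul_eq_zero.mp h1).resolve_right (ne_of_gt ?_)
    refine Finset.sum_pos (fun a _ => mul_pos (hw a) ?_) ⟨⟨0, hn⟩, by simp⟩
    have := eval_derivative_nodal_ne_zero hv a
    positivity
  subst hθ
  simp only [mul_zero, zero_mul, add_zero] at hT
  have hB : ∀ a b, b ≠ a → (Lagrange.nodal (Finset.univ.erase a) v).eval (v b) = 0 :=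
    fun a b hb => Lagrange.eval_nodal_at_node (by simpa using hb)
  have hBa : ∀ a, (Lagrange.nodal (Finset.univ.erase a) v).eval (v a) ≠ 0 := fun a => by
    rw [← Lagrange.eval_nodal_derivative_eval_node_eq (Finset.mem_univ a)]
    exact eval_derivative_nodal_ne_zero hv a
  have hBdeg : ∀ a, (Lagrange.nodal (Finset.univ.erase a) v).natDegree = n - 1 := fun a => by
    simp [Lagrange.natDegree_nodal]
  have hPdeg : P.natDegree = n := by simp [hP, Lagrange.natDegree_nodal]
  -- Besides a simple zero at `v a`, this test polynomial has only double zeros at the other nodes,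
  -- which isolates `dv a`.
  have hdv : ∀ a, dv a = 0 := fun a => by
    have h1 := hT (P * Lagrange.nodal (Finset.univ.erase a) v)
      (natDegree_mul_le.trans (by rw [hBdeg, hPdeg]; omega))
    rw [Finset.sum_eq_single a (fun b _ hb => by simp [hPv, hB a b hb]) (by simp)] at h1
    have h2 := eval_derivative_nodal_ne_zero hv a
    rw [← hP] at h2
    simpa [hPv, hBa, (hw a).ne', h2] using h1
  -- With `dv` gone only values at nodes remain, and this square is nonzero only at `v a`.
  have hdw : ∀ a, dw a = 0 := fun a => by
    have h1 := hT (Lagrange.nodal (Finset.univ.erase a) v ^ 2)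
      (natDegree_pow_le.trans (by rw [hBdeg]; omega))
    rw [Finset.sum_eq_single a (fun b _ hb => by simp [hdv, hB a b hb]) (by simp)] at h1
    simpa [hdv, hBa] using h1
  ext a
  · exact hdw a
  · exact hdv a
  · rfl

theorem isOpen_setOf_eqmomAdmissible (n : ℕ) :
    IsOpen {p : (Fin n → ℝ) × (Fin n → ℝ) × ℝ | EqmomAdmissible p.1 p.2.1 p.2.2} := by
  have e : {p : (Fin n → ℝ) × (Fin n → ℝ) × ℝ | EqmomAdmissible p.1 p.2.1 p.2.2} =
      (⋂ a, {p | 0 < p.1 a}) ∩ (⋂ a, ⋂ b, {p | a ≠ b → p.2.1 a ≠ p.2.1 b}) ∩ {p | 0 < p.2.2} := by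
    ext p
    simp only [Set.mem_inter_iff, Set.mem_iInter, Set.mem_ofPred_eq]
    exact ⟨fun h => ⟨⟨h.weight_pos, fun a b hab => h.node_injective.ne hab⟩, h.variance_pos⟩,
      fun h => ⟨h.1.1, fun a b hab => by_contra fun hne => h.1.2 a b hne hab, h.2⟩⟩
  rw [e]
  refine ((isOpen_iInter_of_finite fun a => ?_).inter (isOpen_iInter_of_finite fun a =>
    isOpen_iInter_of_finite fun b => ?_)).inter ?_
  · exact isOpen_lt continuous_const (by fun_prop)
  · by_cases hab : a = b
    · simp [hab]
    · simp only [ne_eq, hab, not_false_eq_true, forall_const]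
      exact isOpen_ne_fun (by fun_prop) (by fun_prop)
  · exact isOpen_lt continuous_const (by fun_prop)

/-- At a realizable moment vector the moment map has a local inverse, and the derivative of the
closure is given by the tangent functional. -/
theorem eqmomClosure_local_structure {n : ℕ} (hn : 1 ≤ n)
    {p : (Fin n → ℝ) × (Fin n → ℝ) × ℝ} (hp : EqmomAdmissible p.1 p.2.1 p.2.2) :
    eqmomRealizable n ∈ 𝓝 (eqmomMomentVector p.1 p.2.1 p.2.2) ∧
    ∃ c' : (Fin (2 * n + 1) → ℝ) →L[ℝ] ℝ,
      HasFDerivAt (eqmomClosure n) c' (eqmomMomentVector p.1 p.2.1 p.2.2) ∧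
      ∀ M : Fin (2 * n + 1) → ℝ, ∃ d : (Fin n → ℝ) × (Fin n → ℝ) × ℝ,
        (∀ k : Fin (2 * n + 1), tangentFunctional p d (X ^ (k : ℕ)) = M k) ∧
        c' M = tangentFunctional p d (X ^ (2 * n + 1)) := by
  choose F' hF' hF'd using fun q => exists_hasStrictFDerivAt_momentFunctional p q
  set F : (Fin n → ℝ) × (Fin n → ℝ) × ℝ → Fin (2 * n + 1) → ℝ := fun x k =>
    momentFunctional x.1 x.2.1 x.2.2 (X ^ (k : ℕ)) with hF
  set L : ((Fin n → ℝ) × (Fin n → ℝ) × ℝ) →L[ℝ] (Fin (2 * n + 1) → ℝ) :=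
    ContinuousLinearMap.pi fun k => F' (X ^ (k : ℕ)) with hL
  have hFL : HasStrictFDerivAt F L p := hasStrictFDerivAt_pi.mpr fun k => hF' _
  have hLd : ∀ d k, L d k = tangentFunctional p d (X ^ (k : ℕ)) := fun d k => hF'd _ d
  have hFU : ∀ x : (Fin n → ℝ) × (Fin n → ℝ) × ℝ, EqmomAdmissible x.1 x.2.1 x.2.2 →
      eqmomMomentVector x.1 x.2.1 x.2.2 = F x := fun x hx => by
    funext k
    exact eqmomMoment_eq_momentFunctional _ _ hx.variance_pos _
  have hinj : Function.Injective L.toLinearMap := by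
    rw [← LinearMap.ker_eq_bot, LinearMap.ker_eq_bot']
    intro d hd
    refine eq_zero_of_tangentFunctional_eq_zero hn hp fun q hq => ?_
    refine linearMap_eq_of_natDegree_le (L' := 0) (fun k hk => ?_) hq
    rw [← hLd d ⟨k, by omega⟩]
    exact congrFun hd _
  let e : ((Fin n → ℝ) × (Fin n → ℝ) × ℝ) ≃L[ℝ] (Fin (2 * n + 1) → ℝ) :=
    (LinearEquiv.ofInjectiveOfFinrankEq L.toLinearMap hinj
      (by simp; omega)).toContinuousLinearEquiv
  have he : (e : ((Fin n → ℝ) × (Fin n → ℝ) × ℝ) →L[ℝ] (Fin (2 * n + 1) → ℝ)) = L := by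
    refine ContinuousLinearMap.ext fun d => ?_
    rfl
  rw [← he] at hFL
  have hU := (isOpen_setOf_eqmomAdmissible n).mem_nhds hp
  rw [hFU p hp]
  refine ⟨?_, (F' (X ^ (2 * n + 1))).comp (e.symm : _ →L[ℝ] _), ?_, fun M => ⟨e.symm M, ?_, ?_⟩⟩
  · rw [← hFL.map_nhds_eq_of_equiv]
    refine mem_of_superset (image_mem_map hU) ?_
    rintro _ ⟨x, hx, rfl⟩
    exact ⟨x.1, x.2.1, x.2.2, hx, hFU x hx⟩
  · have hg := hFL.to_localInverse.hasFDerivAt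
    have hgp : hFL.localInverse F e p (F p) = p := hFL.localInverse_apply_image
    have hG := (hF' (X ^ (2 * n + 1))).hasFDerivAt
    rw [← hgp] at hG
    refine (hG.comp (F p) hg).congr_of_eventuallyEq ?_
    -- Admissibility is open, so the local inverse stays admissible nearby. There the closure is the
    -- moment of order `2 n + 1` composed with the local inverse, whatever parameters the choice in
    -- `eqmomClosure` selects.
    have hmem : ∀ᶠ M in 𝓝 (F p), hFL.localInverse F e p M ∈
        {p : (Fin n → ℝ) × (Fin n → ℝ) × ℝ | EqmomAdmissible p.1 p.2.1 p.2.2} := by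
      refine hFL.localInverse_continuousAt.eventually_mem ?_
      rwa [hgp]
    filter_upwards [hFL.eventually_right_inverse, hmem] with M hM hMU
    conv_lhs => rw [← hM]
    rw [← hFU _ hMU, eqmomClosure_eqmomMomentVector hn hMU]
    exact eqmomMoment_eq_momentFunctional _ _ hMU.variance_pos _
  · intro k
    rw [← hLd, ← he]
    exact congrFun (e.apply_symm_apply M) k
  · exact hF'd _ _

theorem isOpen_eqmomRealizable {n : ℕ} (hn : 1 ≤ n) : IsOpen (eqmomRealizable n) := by
  rw [isOpen_iff_mem_nhds]
  rintro _ ⟨w, v, θ, h, rfl⟩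
  exact (eqmomClosure_local_structure hn (p := (w, v, θ)) h).1

theorem differentiableOn_eqmomClosure {n : ℕ} (hn : 1 ≤ n) :
    DifferentiableOn ℝ (eqmomClosure n) (eqmomRealizable n) := by
  rintro _ ⟨w, v, θ, h, rfl⟩
  obtain ⟨-, c', hc', -⟩ := eqmomClosure_local_structure hn (p := (w, v, θ)) h
  exact hc'.differentiableAt.differentiableWithinAt

/-! ## Real diagonalizability -/

/-- The weighted mean `b` of the nodes for which `(X - b) ∏ (X - v a)²` is annihilated by all
tangent functionals. -/
theorem exists_tangentFunctional_eq_zero {n : ℕ} (hn : 1 ≤ n)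
    {p : (Fin n → ℝ) × (Fin n → ℝ) × ℝ} (hp : EqmomAdmissible p.1 p.2.1 p.2.2) :
    ∃ b : ℝ, ∀ d, tangentFunctional p d
      (heatFlow (-p.2.2) ((X - C b) * Lagrange.nodal Finset.univ p.2.1 ^ 2)) = 0 := by
  obtain ⟨w, v, θ⟩ := p
  set P := Lagrange.nodal Finset.univ v with hP
  have hPv : ∀ a, P.eval (v a) = 0 := fun a => Lagrange.eval_nodal_at_node (Finset.mem_univ a)
  set S := ∑ a, w a * (derivative P).eval (v a) ^ 2 with hS
  have hS0 : 0 < S := by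
    refine Finset.sum_pos (fun a _ => mul_pos (hp.weight_pos a) ?_) ⟨⟨0, hn⟩, by simp⟩
    have := eval_derivative_nodal_ne_zero hp.node_injective a
    positivity
  -- The second derivative of `(X - b) P²` at `v a` is `2 (v a - b) P' (v a)²`; this `b` makes the
  -- sum weighted by `w a` vanish.
  refine ⟨(∑ a, w a * (derivative P).eval (v a) ^ 2 * v a) / S, fun d => ?_⟩
  set b := (∑ a, w a * (derivative P).eval (v a) ^ 2 * v a) / S with hb
  rw [tangentFunctional_apply]
  simp only [heatFlow_heatFlow_neg]
  have h : ∀ a, d.1 a * ((X - C b) * P ^ 2).eval (v a) +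
      w a * d.2.1 a * (derivative ((X - C b) * P ^ 2)).eval (v a) +
      w a * (1 / 2 * d.2.2) * (derivative (derivative ((X - C b) * P ^ 2))).eval (v a) =
      d.2.2 * (w a * (derivative P).eval (v a) ^ 2 * v a -
        b * (w a * (derivative P).eval (v a) ^ 2)) := fun a => by
    simp [sq, hPv]
    ring
  rw [Finset.sum_congr rfl fun a _ => h a, ← Finset.mul_sum, Finset.sum_sub_distrib,
    ← Finset.mul_sum, ← hS, hb, div_mul_cancel₀ _ hS0.ne', sub_self, mul_zero]

/-- A matrix with ones on the superdiagonal whose last row is minus the lower coefficients of a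
polynomial with simple real roots is real diagonalizable. -/
theorem isRealDiagonalizable_of_companion {m : ℕ} {A : Matrix (Fin (m + 1)) (Fin (m + 1)) ℝ}
    {c : ℝ[X]} (hc : c.Monic) (hdeg : c.natDegree = m + 1)
    (hA : ∀ i j, i ≠ Fin.last m → A i j = if (j : ℕ) = i + 1 then 1 else 0)
    (hlast : ∀ j : Fin (m + 1), A (Fin.last m) j = -c.coeff j) {y : Fin (m + 1) → ℝ}
    (hy : Function.Injective y) (hroot : ∀ j, c.eval (y j) = 0) : IsRealDiagonalizable A := by
  -- The columns `(1, y j, …, y j ^ m)` are the eigenvectors: the superdiagonal rows shift powers,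
  -- and the last row uses `c (y j) = 0`.
  have hdet : IsUnit (Matrix.vandermonde y).transpose.det := by
    rw [Matrix.det_transpose]
    exact (Matrix.det_vandermonde_ne_zero_iff.mpr hy).isUnit
  obtain ⟨P, hP⟩ := (Matrix.isUnit_iff_isUnit_det _).mpr hdet
  refine ⟨P, y, ?_⟩
  rw [Units.eq_mul_inv_iff_mul_eq, hP]
  ext i j
  rw [Matrix.mul_apply, Matrix.mul_diagonal]
  simp only [Matrix.transpose_apply, Matrix.vandermonde_apply]
  by_cases hi : i = Fin.last m
  · subst hi
    have h0 := hroot j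
    rw [hc.as_sum, hdeg, eval_add, eval_finsetSum, Finset.sum_range] at h0
    simp only [eval_mul, eval_C, eval_pow, eval_X] at h0
    simp only [hlast, neg_mul, Finset.sum_neg_distrib, Fin.val_last, ← pow_succ]
    linarith
  · have hi' : (i : ℕ) + 1 < m + 1 := by
      have := Fin.val_lt_last hi
      omega
    rw [Finset.sum_eq_single ⟨i + 1, hi'⟩]
    · simp [hA _ _ hi, pow_succ]
    · intro b _ hb
      rw [hA _ _ hi, if_neg fun h => hb (Fin.ext h), zero_mul]
    · simp

theorem isRealDiagonalizable_eqmomMatrix {n : ℕ} (hn : 1 ≤ n) {M : Fin (2 * n + 1) → ℝ}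
    (hM : M ∈ eqmomRealizable n) : IsRealDiagonalizable (eqmomMatrix n M) := by
  obtain ⟨w, v, θ, h, rfl⟩ := hM
  obtain ⟨-, c', hc', hT⟩ := eqmomClosure_local_structure hn (p := (w, v, θ)) h
  obtain ⟨b, hb⟩ := exists_tangentFunctional_eq_zero hn (p := (w, v, θ)) h
  obtain ⟨hdeg, hm, y, hy, hroot⟩ :=
    exists_strictMono_roots_heatFlow_neg_mul_nodal_sq h.variance_pos v b
  refine isRealDiagonalizable_of_companion hm hdeg (fun i j hi => ?_) (fun j => ?_)
    hy.injective hroot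
  · simp [eqmomMatrix, hi]
  -- Take `d` to be the parameter variation that changes only the `j`-th moment. Since `c` is
  -- annihilated, the top moment then changes by `-c.coeff j`.
  · obtain ⟨d, hd, hd'⟩ := hT (Pi.single j 1)
    simp only [eqmomMatrix, Matrix.of_apply, if_true]
    rw [hc'.fderiv, hd', linearMap_X_pow_eq_of_monic _ hm hdeg (hb d)]
    simp [hd, Pi.single_apply]

theorem IsRealDiagonalizable.smul {ι : Type} [Fintype ι] [DecidableEq ι] {A : Matrix ι ι ℝ}
    (hA : IsRealDiagonalizable A) (a : ℝ) : IsRealDiagonalizable (a • A) := by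
  obtain ⟨P, e, rfl⟩ := hA
  exact ⟨P, a • e, by rw [Matrix.diagonal_smul, Matrix.mul_smul, Matrix.smul_mul]⟩

theorem IsRealDiagonalizable.blockDiagonal' {o : Type} [Fintype o] [DecidableEq o] {ι : o → Type}
    [∀ m, Fintype (ι m)] [∀ m, DecidableEq (ι m)] {A : ∀ m, Matrix (ι m) (ι m) ℝ}
    (hA : ∀ m, IsRealDiagonalizable (A m)) : IsRealDiagonalizable (Matrix.blockDiagonal' A) := by
  choose P e h using hA
  refine ⟨⟨Matrix.blockDiagonal' fun m => (P m : Matrix (ι m) (ι m) ℝ),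
    Matrix.blockDiagonal' fun m => ((P m)⁻¹ : (Matrix (ι m) (ι m) ℝ)ˣ), ?_, ?_⟩,
    fun x => e x.1 x.2, ?_⟩
  · rw [← Matrix.blockDiagonal'_mul]
    simp only [Units.mul_inv]
    exact Matrix.blockDiagonal'_one
  · rw [← Matrix.blockDiagonal'_mul]
    simp only [Units.inv_mul]
    exact Matrix.blockDiagonal'_one
  · rw [Units.inv_mk, ← Matrix.blockDiagonal'_diagonal, ← Matrix.blockDiagonal'_mul,
      ← Matrix.blockDiagonal'_mul]
    exact congrArg _ (funext h)

/-- In each direction all coefficient matrices are scalar multiples of one block, so every linear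
combination is again block diagonal with scaled copies of these blocks. -/
theorem isHyperbolic_dvdEqmomSystem {D Dx N : ℕ} (hD : Dx ≤ D) (τ : ℝ)
    (l : Fin N → EuclideanSpace ℝ (Fin D)) (n : Fin N → ℕ) (hn : ∀ m, 1 ≤ n m) :
    (dvdEqmomSystem hD τ l n).IsHyperbolic := by
  intro U hU y
  have h : ∑ i, y i • (dvdEqmomSystem hD τ l n).coeff i U = Matrix.blockDiagonal' fun m =>
      (∑ i, y i * l m (Fin.castLE hD i)) • eqmomMatrix (n m) (dvdBlock U m) := by
    ext ⟨m, k⟩ ⟨m', k'⟩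
    simp only [dvdEqmomSystem, Matrix.sum_apply, Matrix.smul_apply, Matrix.blockDiagonal'_apply]
    split_ifs with hm
    · subst hm
      simp [Finset.sum_mul, mul_assoc]
    · simp
  rw [h]
  exact IsRealDiagonalizable.blockDiagonal' fun m =>
    (isRealDiagonalizable_eqmomMatrix (hn m) (hU m)).smul _

theorem mainTheorem5 {D Dx N : ℕ} (hD : Dx ≤ D) (τ : ℝ) (hτ : 0 < τ)
    (l : Fin N → EuclideanSpace ℝ (Fin D)) (hl : ∀ m, ‖l m‖ = 1)
    (n : Fin N → ℕ) (hn : ∀ m, 1 ≤ n m) :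
    (∀ m, IsOpen (eqmomRealizable (n m)) ∧
      (∀ (w v : Fin (n m) → ℝ) (θ : ℝ), EqmomAdmissible w v θ →
        eqmomClosure (n m) (eqmomMomentVector w v θ) = eqmomMoment w v θ (2 * n m + 1)) ∧
      DifferentiableOn ℝ (eqmomClosure (n m)) (eqmomRealizable (n m))) ∧
    (dvdEqmomSystem hD τ l n).IsHyperbolic :=
  ⟨fun m => ⟨isOpen_eqmomRealizable (hn m),
    fun _ _ _ h => eqmomClosure_eqmomMomentVector (hn m) h,
    differentiableOn_eqmomClosure (hn m)⟩, isHyperbolic_dvdEqmomSystem hD τ l n hn⟩
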